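/- For integers $m\ge 1$ put $c_m=1-\frac{6}{(m+2)(m+3)}$ and $h^{(m)}_{r,s}=\frac{[r(m+3)-s(m+2)]^2-1}{4(m+2)(m+3)}$, so that $h^{(m)}_{m+1,1}=\frac{m(m+1)}{4}$. Let $n\ge 3$ and $m\ge 2$, and let $V=(V,\mathbf 1,\omega,Y)$ be a vertex operator algebra over $\mathbb C$, with $Y(u,z)=\sum_{k\in\mathbb Z}u_kz^{-k-1}$, satisfying the following two conditions. (I) $V$ is simple, of OZ type (i.e. $V=\bigoplus_{k\ge 0}V_k$, $V_0=\mathbb C\mathbf 1$, $V_1=0$), and generated by its Griess algebra $V_2$. (II) $V_2$ is linearly spanned by vectors $\omega^{ij}=\omega^{ji}$, $1\le i<j\le n$, such that each vertex subalgebra generated by $\omega^{ij}$, with conformal vector $\omega^{ij}$, is isomorphic to the simple Virasoro vertex operator algebra $L(c_m,0)$, and, for distinct $i,j,k,l\in\{1,\dots,n\}$ (for distinct $i,j,l$ in the relations that involve only these), $$\omega^{ij}_1\omega^{jl}=\tfrac12 h^{(m)}_{m+1,1}(\omega^{ij}+\omega^{jl}-\omega^{il}),\qquad \omega^{ij}_p\omega^{kl}=0\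 (p\ge 0),$$ $$\omega^{ij}_3\omega^{ij}=\tfrac{c_m}{2}\mathbf 1,\qquad \omega^{ij}_3\omega^{jl}=\tfrac{c_m h^{(m)}_{m+1,1}}{8}\mathbf 1 .$$ Let $(\cdot|\cdot)$ be the non-degenerate bilinear form on $V$ with $(\mathbf 1|\mathbf 1)=1$ and $(v|Y(u,z)w)=(Y(e^{zL(1)}(-z^{-2})^{L(0)}u,z^{-1})v|w)$ for all $u,v,w\in V$, where $Y(\omega,z)=\sum_k L(k)z^{-k-2}$. Let $(\cdot|\cdot)_H$ be the associated Hermitian form on $V$, i.e. the form that is linear in the first and conjugate-linear in the second variable and satisfies $(au|bv)_H=a\bar b\,(u|v)$ for all $a,b\in\mathbb C$ and all vectors $u,v$ of the form $\omega^{i_1j_1}_{k_1}\cdots\omega^{i_sj_s}_{k_s}\mathbf 1$ with $s\ge 0$, $i_t<j_t$, $k_t\in\mathbb Z$. If $n=3$, then the restriction of $(\cdot|\cdot)_H$ to $V_2$ is positive definite if and only if $m\le 3$. If $n\ge 4$, then the restriction of $(\cdot|\cdot)_H$ to $V_2$ is positive definite if and only if $m=2$. -/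

import Mathlib

open scoped ComplexConjugate

noncomputable section

/-- A vertex operator algebra `(V, 1, ω, Y)` over `ℂ`. The state-field map `Y` sends `u` to
`Y(u, z) = ∑ uₙ z^{-n-1}`, a linear map from `V` to Laurent series with coefficients in `V`
(so `uₙ v = 0` for `n ≫ 0` is built in); `uₙ` is `VertexOperator.ncoeff (Y u) n`. -/
structure VertexOperatorAlgebra (V : Type*) [AddCommGroup V] [Module ℂ V] where
  /-- the state-field correspondence -/
  Y : V →ₗ[ℂ] VertexOperator ℂ V
  /-- the vacuum vector -/
  vac : V
  /-- the conformal vector -/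
  conf : V
  /-- the central charge -/
  charge : ℂ
  /-- the homogeneous subspaces `V_k` -/
  gr : ℤ → Submodule ℂ V
  gr_internal : DirectSum.IsInternal gr
  gr_finite : ∀ k, Module.Finite ℂ (gr k)
  gr_bounded : ∃ N : ℤ, ∀ k < N, gr k = ⊥
  vac_mem : vac ∈ gr 0
  conf_mem : conf ∈ gr 2
  /-- `Y(1, z) = id` -/
  vac_mode : ∀ (n : ℤ) (v : V),
    VertexOperator.ncoeff (Y vac) n v = if n = -1 then v else 0
  /-- `Y(u, z) 1` has no negative powers of `z` and constant term `u` -/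
  mode_vac_of_nonneg : ∀ (u : V) (n : ℤ), 0 ≤ n → VertexOperator.ncoeff (Y u) n vac = 0
  mode_neg_one_vac : ∀ u : V, VertexOperator.ncoeff (Y u) (-1) vac = u
  /-- the Virasoro relations for `L(p) = ω_{p+1}` -/
  virasoro : ∀ (p q : ℤ) (v : V),
    VertexOperator.ncoeff (Y conf) (p + 1) (VertexOperator.ncoeff (Y conf) (q + 1) v) -
      VertexOperator.ncoeff (Y conf) (q + 1) (VertexOperator.ncoeff (Y conf) (p + 1) v) =
    ((p : ℂ) - q) • VertexOperator.ncoeff (Y conf) (p + q + 1) v +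
      if p + q = 0 then ((((p : ℂ) ^ 3 - p) / 12) * charge) • v else 0
  /-- `L(0)` acts on `V_k` as `k` -/
  L_zero : ∀ (k : ℤ), ∀ v ∈ gr k, VertexOperator.ncoeff (Y conf) 1 v = (k : ℂ) • v
  /-- the Jacobi identity, in components (all sums have finite support by truncation) -/
  jacobi : ∀ (u v w : V) (p q r : ℤ),
    ∑ᶠ i : ℕ, (Ring.choose p i : ℤ) •
      VertexOperator.ncoeff (Y (VertexOperator.ncoeff (Y u) (r + i) v)) (p + q - i) w =
    ∑ᶠ i : ℕ, ((-1 : ℤ) ^ i * (Ring.choose r i : ℤ)) •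
      (VertexOperator.ncoeff (Y u) (p + r - i) (VertexOperator.ncoeff (Y v) (q + i) w) -
        (Int.negOnePow r : ℤ) •
          VertexOperator.ncoeff (Y v) (q + r - i) (VertexOperator.ncoeff (Y u) (p + i) w))

namespace VertexOperatorAlgebra

variable {V : Type*} [AddCommGroup V] [Module ℂ V] (A : VertexOperatorAlgebra V)

/-- The `n`-th mode `uₙ` of `u`. -/
def mode (u : V) (n : ℤ) : Module.End ℂ V := VertexOperator.ncoeff (A.Y u) n

/-- `L(n) = ω_{n+1}`. -/
def L (n : ℤ) : Module.End ℂ V := A.mode A.conf (n + 1)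

/-- `V` is simple: `V` is an irreducible module over itself. -/
def IsSimple : Prop :=
  Nontrivial V ∧ ∀ W : Submodule ℂ V, (∀ u : V, ∀ n : ℤ, ∀ w ∈ W, A.mode u n w ∈ W) →
    W = ⊥ ∨ W = ⊤

/-- `V` is of OZ type: `V = ⨁_{k ≥ 0} V_k`, `V_0 = ℂ1` and `V_1 = 0`. -/
def IsOZ : Prop :=
  (∀ k < 0, A.gr k = ⊥) ∧ A.gr 0 = Submodule.span ℂ {A.vac} ∧ A.gr 1 = ⊥

/-- A subspace that contains the vacuum and is closed under all products `uₙ v`. -/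
def IsVertexSubalgebra (U : Submodule ℂ V) : Prop :=
  A.vac ∈ U ∧ ∀ u ∈ U, ∀ n : ℤ, ∀ v ∈ U, A.mode u n v ∈ U

/-- The vertex subalgebra `⟨S⟩` generated by a set `S`. -/
def generatedBy (S : Set V) : Submodule ℂ V :=
  sInf {U : Submodule ℂ V | A.IsVertexSubalgebra U ∧ S ⊆ U}

/-- `U`, with the vector `x` and the operators `L n` restricted to `U`, is the irreducible highest
weight module `L(c, 0)` of the Virasoro algebra (central charge `c`, highest weight `0`), with
highest weight vector `x`. The condition `L(-1) x = 0` is automatic in `L(c, 0)`. -/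
structure IsSimpleVirasoroModule (U : Submodule ℂ V) (L : ℤ → Module.End ℂ V) (x : V) (c : ℂ) :
    Prop where
  vec_mem : x ∈ U
  vec_ne_zero : x ≠ 0
  stable : ∀ p : ℤ, ∀ u ∈ U, L p u ∈ U
  relation : ∀ p q : ℤ, ∀ u ∈ U, L p (L q u) - L q (L p u) =
    ((p : ℂ) - q) • L (p + q) u + if p + q = 0 then ((((p : ℂ) ^ 3 - p) / 12) * c) • u else 0
  highest : ∀ p : ℤ, 0 ≤ p → L p x = 0
  irreducible : ∀ W : Submodule ℂ V, W ≤ U → (∀ p : ℤ, ∀ w ∈ W, L p w ∈ W) → W = ⊥ ∨ W = U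

/-- `e ∈ V_2` is a simple Virasoro vector of central charge `c`: the vertex subalgebra `⟨e⟩`, with
conformal vector `e`, is isomorphic to the simple Virasoro vertex operator algebra `L(c, 0)`.
As `⟨e⟩` is generated by `e`, this says that `⟨e⟩` is the irreducible Virasoro module `L(c, 0)`
under `L^e(n) = e_{n+1}`, with the vacuum as highest weight vector. -/
def IsSimpleVirasoroVector (e : V) (c : ℂ) : Prop :=
  e ∈ A.gr 2 ∧
    IsSimpleVirasoroModule (A.generatedBy {e}) (fun p => A.mode e (p + 1)) A.vac c

/-- The invariance `(v | Y(u,z)w) = (Y(e^{zL(1)}(-z^{-2})^{L(0)}u, z^{-1})v | w)`, read off at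
`z^{-n-1}` for homogeneous `u ∈ V_k`:
`(v | uₙ w) = ∑_{i ≥ 0} ((-1)^k / i!) ((L(1)^i u)_{2k-n-i-2} v | w)`; the sum is finite. -/
def IsInvariant (B : V →ₗ[ℂ] V →ₗ[ℂ] ℂ) : Prop :=
  ∀ k : ℤ, ∀ u ∈ A.gr k, ∀ (v w : V) (n : ℤ),
    B v (A.mode u n w) =
      ∑ᶠ i : ℕ, ((Int.negOnePow k : ℤ) : ℂ) / (i.factorial : ℂ) *
        B (A.mode (((A.L 1) ^ i) u) (2 * k - n - i - 2) v) w

/-- The non-degenerate invariant bilinear form `(·|·)` with `(1|1) = 1`. -/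
structure IsNormalizedInvariantForm (B : V →ₗ[ℂ] V →ₗ[ℂ] ℂ) : Prop where
  invariant : A.IsInvariant B
  nondegenerate : B.Nondegenerate
  vac_vac : B A.vac A.vac = 1

/-- The vectors `ω^{i₁j₁}_{m₁} ⋯ ω^{i_sj_s}_{m_s} 1` with `i_k < j_k` and `m_k ∈ ℤ`, `s ≥ 0`. -/
inductive IsMonomial {n : ℕ} (om : Fin n → Fin n → V) : V → Prop
  | vac : IsMonomial om A.vac
  | mode (i j : Fin n) (hij : i < j) (p : ℤ) (u : V) (hu : IsMonomial om u) :
      IsMonomial om (A.mode (om i j) p u)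

/-- `H` is the Hermitian form `(·|·)_H` associated to the vectors `ω^{ij}`: the sesquilinear form
(linear in the first variable, conjugate linear in the second) with
`(au|bv)_H = a b̄ (u|v)` for `a, b ∈ ℂ` and all monomials `u, v` in the modes of the `ω^{ij}`,
where `(·|·)` is the normalized invariant bilinear form. -/
def IsAssociatedHermitianForm {n : ℕ} (om : Fin n → Fin n → V)
    (H : V →ₗ[ℂ] V →ₛₗ[starRingEnd ℂ] ℂ) : Prop :=
  ∃ B : V →ₗ[ℂ] V →ₗ[ℂ] ℂ, A.IsNormalizedInvariantForm B ∧
    ∀ u v : V, A.IsMonomial om u → A.IsMonomial om v →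
      ∀ a b : ℂ, H (a • u) (b • v) = a * conj b * B u v

end VertexOperatorAlgebra

/-- `c_m = 1 - 6 / ((m+2)(m+3))`. -/
def centralChargeC (m : ℕ) : ℂ := 1 - 6 / (((m : ℂ) + 2) * ((m : ℂ) + 3))

/-- `h^{(m)}_{r,s} = ([r(m+3) - s(m+2)]² - 1) / (4(m+2)(m+3))`. -/
def weightH (m r s : ℕ) : ℂ :=
  (((r : ℂ) * ((m : ℂ) + 3) - (s : ℂ) * ((m : ℂ) + 2)) ^ 2 - 1) /
    (4 * ((m : ℂ) + 2) * ((m : ℂ) + 3))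

namespace VertexOperatorAlgebra

variable {V : Type*} [AddCommGroup V] [Module ℂ V] (A : VertexOperatorAlgebra V)

/-- Condition (I): `V` is simple, of OZ type, and generated by its Griess algebra `V_2`. -/
structure ConditionI : Prop where
  simple : A.IsSimple
  oz : A.IsOZ
  generated : A.generatedBy (A.gr 2 : Set V) = ⊤

/-- Condition (II) for the vectors `ω^{ij}`, `1 ≤ i, j ≤ n`, `i ≠ j`. (The values `om i i` play
no role.) -/
structure ConditionII (n m : ℕ) (om : Fin n → Fin n → V) : Prop where
  symm : ∀ i j, om i j = om j i
  span : A.gr 2 = Submodule.span ℂ {v | ∃ i j : Fin n, i < j ∧ v = om i j}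
  virasoro : ∀ i j, i ≠ j → A.IsSimpleVirasoroVector (om i j) (centralChargeC m)
  product : ∀ i j l, i ≠ j → i ≠ l → j ≠ l →
    A.mode (om i j) 1 (om j l) = (weightH m (m + 1) 1 / 2) • (om i j + om j l - om i l)
  disjoint : ∀ i j k l, i ≠ j → i ≠ k → i ≠ l → j ≠ k → j ≠ l → k ≠ l →
    ∀ p : ℤ, 0 ≤ p → A.mode (om i j) p (om k l) = 0
  norm : ∀ i j, i ≠ j → A.mode (om i j) 3 (om i j) = (centralChargeC m / 2) • A.vac
  adjacent : ∀ i j l, i ≠ j → i ≠ l → j ≠ l →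
    A.mode (om i j) 3 (om j l) = (centralChargeC m * weightH m (m + 1) 1 / 8) • A.vac

/-- `H` is positive definite on the subspace `W`: `(v|v)_H` is a positive real for `0 ≠ v ∈ W`. -/
def PositiveDefiniteOn (H : V →ₗ[ℂ] V →ₛₗ[starRingEnd ℂ] ℂ) (W : Submodule ℂ V) : Prop :=
  ∀ v ∈ W, v ≠ 0 → (H v v).im = 0 ∧ 0 < (H v v).re

end VertexOperatorAlgebra

end

/-! Since $V_1=0$, $L(1)$ kills $V_2$, and invariance gives $(v|u)=(u_3v|\mathbf 1)$ for $u\in V_2$.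
So condition (II) fixes the Gram matrix $G$ of the $\omega^{ij}$, seen as edges of $K_n$: $c/2$ on
the diagonal, $ch/8$ for edges sharing a vertex, $0$ for disjoint edges, with $h=m(m+1)/4$ and
$c>0$.

With $N$ the vertex-edge incidence matrix, $G=\frac c2(1-\frac h2)I+\frac{ch}8N^TN$
(`gramEntry_eq_incidence`), positive definite if $h<2$. For $n=3$ all edges meet, so $G=\frac
c2(1-\frac h4)I+\frac{ch}8J$ with $J$ the all-ones matrix (`gramEntry_fin_three`), positive definite
if $h<4$. Conversely, a difference of two adjacent edges has norm $c(1-\frac h4)$ and an alternating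
4-cycle has norm $c(2-h)$. The values $h=\frac32,3,5$ at $m=2,3,4$ decide. -/

noncomputable section

/-! ### The invariant form on $V_2$ -/

namespace VertexOperatorAlgebra

variable {V : Type*} [AddCommGroup V] [Module ℂ V] (A : VertexOperatorAlgebra V)

/-- In a vertex operator algebra with `V_1 = 0`, the operator `L(1)` vanishes on `V_2`. -/
theorem L_one_eq_zero (h1 : A.gr 1 = ⊥) {u : V} (hu : u ∈ A.gr 2) : A.L 1 u = 0 := by
  set T : Module.End ℂ V := A.L 0 with hT
  have hTgr : ∀ k : ℤ, ∀ v ∈ A.gr k, T v = (k : ℂ) • v := A.L_zero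
  have hle : ∀ k : ℤ, A.gr k ≤ T.eigenspace (k : ℂ) := fun k v hv =>
    Module.End.mem_eigenspace_iff.2 (hTgr k v hv)
  -- $[L(0),L(1)]=-L(1)$ lowers the weight from 2 to 1.
  have hx : A.L 1 u ∈ T.eigenspace 1 := by
    rw [Module.End.mem_eigenspace_iff]
    have h := A.virasoro 0 1 u
    have h' : T (A.L 1 u) - A.L 1 (T u) = -(A.L 1 u) := by
      simpa [T, L, mode] using h
    rw [hTgr 2 u hu, map_smul, sub_eq_iff_eq_add] at h'
    rw [h']
    push_cast
    module
  -- As $V_1=0$, the other eigenspaces of $L(0)$ already span $V$; independence of eigenspaces then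
  -- leaves nothing for eigenvalue 1.
  have htop : (⊤ : Submodule ℂ V) ≤ ⨆ μ : ℂ, ⨆ (_ : μ ≠ 1), T.eigenspace μ := by
    rw [← A.gr_internal.submodule_iSup_eq_top]
    refine iSup_le fun k => ?_
    by_cases hk : k = 1
    · rw [hk, h1]
      exact bot_le
    · exact (hle k).trans (le_iSup₂_of_le (k : ℂ) (by exact_mod_cast hk) le_rfl)
  exact Submodule.disjoint_def.1 (T.eigenspaces_iSupIndep 1) _ hx (htop trivial)

/-- If `V_1 = 0`, an invariant form is given on `V_2` by the third products. -/
theorem IsInvariant.apply_eq_mode_three {A : VertexOperatorAlgebra V} {B : V →ₗ[ℂ] V →ₗ[ℂ] ℂ}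
    (hB : A.IsInvariant B) (h1 : A.gr 1 = ⊥) {u : V} (hu : u ∈ A.gr 2) (v : V) :
    B v u = B (A.mode u 3 v) A.vac := by
  -- With $u=u_{-1}\mathbf 1$, the $i=0$ term has mode $2\cdot2+1-2=3$ and sign $+1$; the later
  -- terms contain $L(1)u=0$.
  have h := hB 2 u hu v A.vac (-1)
  have hv : A.mode u (-1) A.vac = u := A.mode_neg_one_vac u
  rw [hv, finsum_eq_single _ 0] at h
  · simpa using h
  · intro i hi
    obtain ⟨j, rfl⟩ := Nat.exists_eq_succ_of_ne_zero hi
    have hz : ((A.L 1) ^ (j + 1)) u = 0 := by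
      rw [pow_succ, Module.End.mul_apply, A.L_one_eq_zero h1 hu, map_zero]
    have hz0 : ∀ k : ℤ, A.mode 0 k = 0 := fun k => by
      rw [mode, map_zero, map_zero, Pi.zero_apply]
    rw [hz, hz0, LinearMap.zero_apply, map_zero, LinearMap.zero_apply, mul_zero]

end VertexOperatorAlgebra

/-! ### The Gram matrix of the $\omega^{ij}$ -/

/-- The Gram matrix of the vectors `ω^{ij}`, for pairs `{i, j}`, `{k, l}`. -/
def gramEntry (c h : ℝ) {n : ℕ} (p q : Fin n × Fin n) : ℝ :=
  if p = q then c / 2 else c * h / 8 * (({p.1, p.2} : Finset (Fin n)) ∩ {q.1, q.2}).card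

theorem gramEntry_self (c h : ℝ) {n : ℕ} (p : Fin n × Fin n) : gramEntry c h p p = c / 2 :=
  if_pos rfl

theorem gramEntry_of_mem (c h : ℝ) {n : ℕ} {i j k l : Fin n} (x : Fin n) (hij : i < j)
    (hkl : k < l) (hne : i ≠ k ∨ j ≠ l) (hx : x = i ∨ x = j) (hx' : x = k ∨ x = l) :
    gramEntry c h (i, j) (k, l) = c * h / 8 := by
  have hcard : (({i, j} : Finset (Fin n)) ∩ {k, l}).card = 1 := by
    rw [Finset.card_eq_one]
    refine ⟨x, ?_⟩
    ext y
    simp only [Finset.mem_inter, Finset.mem_insert, Finset.mem_singleton]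
    grind
  have hpq : (i, j) ≠ (k, l) := by
    rw [Ne, Prod.mk.injEq, not_and_or]
    exact hne
  rw [gramEntry, if_neg hpq, hcard, Nat.cast_one, mul_one]

theorem gramEntry_of_disjoint (c h : ℝ) {n : ℕ} {i j k l : Fin n} (hik : i ≠ k) (hil : i ≠ l)
    (hjk : j ≠ k) (hjl : j ≠ l) : gramEntry c h (i, j) (k, l) = 0 := by
  have hcard : (({i, j} : Finset (Fin n)) ∩ {k, l}).card = 0 := by
    rw [Finset.card_eq_zero]
    ext y
    simp only [Finset.mem_inter, Finset.mem_insert, Finset.mem_singleton, Finset.notMem_empty]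
    grind
  rw [gramEntry, if_neg (fun e => hik (congrArg Prod.fst e)), hcard, Nat.cast_zero, mul_zero]

namespace VertexOperatorAlgebra

variable {V : Type*} [AddCommGroup V] [Module ℂ V] {A : VertexOperatorAlgebra V}

theorem hermitian_apply_eq_gramEntry {n m : ℕ} {om : Fin n → Fin n → V}
    (h1 : A.gr 1 = ⊥) (hII : A.ConditionII n m om)
    {H : V →ₗ[ℂ] V →ₛₗ[starRingEnd ℂ] ℂ} (hH : A.IsAssociatedHermitianForm om H)
    {c h : ℝ} (hc : centralChargeC m = c) (hh : weightH m (m + 1) 1 = h)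
    (p q : Fin n × Fin n) (hp : p.1 < p.2) (hq : q.1 < q.2) :
    H (om p.1 p.2) (om q.1 q.2) = (gramEntry c h p q : ℂ) := by
  obtain ⟨i, j⟩ := p
  obtain ⟨k, l⟩ := q
  obtain ⟨B, hB, hHB⟩ := hH
  dsimp only at hp hq ⊢
  have hmon : ∀ i j : Fin n, i < j → A.IsMonomial om (om i j) := fun i j hij => by
    have h := IsMonomial.mode i j hij (-1) A.vac (IsMonomial.vac (A := A) (om := om))
    rwa [show A.mode (om i j) (-1) A.vac = om i j from A.mode_neg_one_vac _] at h
  have hval : H (om i j) (om k l) = B (A.mode (om k l) 3 (om i j)) A.vac := by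
    rw [← hB.invariant.apply_eq_mode_three h1 (hII.virasoro k l hq.ne).1]
    simpa using hHB _ _ (hmon i j hp) (hmon k l hq) 1 1
  have hadj : ∀ a b d : Fin n, a ≠ b → a ≠ d → b ≠ d →
      B (A.mode (om a b) 3 (om b d)) A.vac = (c : ℂ) * h / 8 := fun a b d hab had hbd => by
    rw [hII.adjacent a b d hab had hbd, map_smul, LinearMap.smul_apply, hB.vac_vac, hc, hh,
      smul_eq_mul, mul_one]
  rw [hval]
  by_cases hpq : (i, j) = (k, l)
  · obtain ⟨rfl, rfl⟩ := Prod.mk.inj hpq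
    rw [hII.norm i j hp.ne, map_smul, LinearMap.smul_apply, hB.vac_vac, hc]
    simp [gramEntry_self]
  by_cases hik : i = k
  -- In each adjacent case, the symmetry of `om` moves the shared index to the middle, as `adjacent`
  -- requires.
  · subst hik
    have hjl : j ≠ l := fun e => hpq (by rw [e])
    rw [hII.symm i l, hadj l i j hq.ne' hjl.symm hp.ne,
      gramEntry_of_mem c h i hp hq (.inr hjl) (.inl rfl) (.inl rfl)]
    push_cast
    ring
  by_cases hjl : j = l
  · subst hjl
    rw [hII.symm i j, hadj k j i hq.ne (Ne.symm hik) hp.ne',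
      gramEntry_of_mem c h j hp hq (.inl hik) (.inr rfl) (.inr rfl)]
    push_cast
    ring
  by_cases hil : i = l
  · subst hil
    rw [hadj k i j hq.ne (hq.trans hp).ne hp.ne,
      gramEntry_of_mem c h i hp hq (.inl hik) (.inl rfl) (.inr rfl)]
    push_cast
    ring
  by_cases hjk : j = k
  · subst hjk
    rw [hII.symm j l, hII.symm i j, hadj l j i hq.ne' (hp.trans hq).ne' hp.ne',
      gramEntry_of_mem c h j hp hq (.inl hik) (.inr rfl) (.inl rfl)]
    push_cast
    ring
  · rw [hII.disjoint k l i j hq.ne (Ne.symm hik) (Ne.symm hjk) (Ne.symm hil) (Ne.symm hjl) hp.ne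
      3 (by norm_num), gramEntry_of_disjoint c h hik hil hjk hjl]
    simp

end VertexOperatorAlgebra

/-! ### Positivity from decompositions of the Gram matrix -/

/-- A sesquilinear form whose Gram matrix on a spanning family is a positive multiple of the
identity plus a nonnegative multiple of a matrix `NᵀN`, `N` real, is positive definite. -/
theorem sesqForm_pos_of_gram {V ι κ : Type*} [AddCommGroup V] [Module ℂ V] [Fintype ι]
    [DecidableEq ι] [Fintype κ] (H : V →ₗ[ℂ] V →ₛₗ[starRingEnd ℂ] ℂ) (e : ι → V)
    (α β : ℝ) (hα : 0 < α) (hβ : 0 ≤ β) (N : κ → ι → ℝ)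
    (hG : ∀ p q, H (e p) (e q) = ((if p = q then α else 0) + β * ∑ x, N x p * N x q : ℝ))
    (v : V) (hv : v ∈ Submodule.span ℂ (Set.range e)) (hv0 : v ≠ 0) :
    (H v v).im = 0 ∧ 0 < (H v v).re := by
  obtain ⟨a, rfl⟩ := (Submodule.mem_span_range_iff_exists_fun ℂ).1 hv
  have key : H (∑ p, a p • e p) (∑ p, a p • e p) =
      ((α * ∑ p, Complex.normSq (a p) + β * ∑ x, Complex.normSq (∑ p, a p * N x p) : ℝ) : ℂ) := by
    have hexp : H (∑ p, a p • e p) (∑ p, a p • e p) =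
        ∑ p, ∑ q, a p * conj (a q) * H (e p) (e q) := by
      simp only [map_sum, LinearMap.sum_apply, map_smul, LinearMap.smul_apply,
        LinearMap.map_smulₛₗ, smul_eq_mul, Finset.mul_sum]
      rw [Finset.sum_comm]
      exact Finset.sum_congr rfl fun p _ => Finset.sum_congr rfl fun q _ => by ring
    have hdiag : ∑ p, ∑ q, a p * conj (a q) * ((if p = q then α else 0 : ℝ) : ℂ) =
        ((α * ∑ p, Complex.normSq (a p) : ℝ) : ℂ) := by
      push_cast
      rw [Finset.mul_sum]
      refine Finset.sum_congr rfl fun p _ => ?_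
      rw [Finset.sum_eq_single p (fun q _ hq => by simp [hq.symm]) (by simp), if_pos rfl,
        Complex.mul_conj]
      ring
    have hsq : ∑ p, ∑ q, a p * conj (a q) * ((β * ∑ x, N x p * N x q : ℝ) : ℂ) =
        ((β * ∑ x, Complex.normSq (∑ p, a p * N x p) : ℝ) : ℂ) := by
      have hx : ∀ x, (Complex.normSq (∑ p, a p * N x p) : ℂ) =
          ∑ p, ∑ q, (a p * N x p) * (conj (a q) * N x q) := fun x => by
        rw [← Complex.mul_conj, map_sum, Finset.sum_mul_sum]
        simp only [map_mul, Complex.conj_ofReal]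
      push_cast
      simp only [hx, Finset.mul_sum]
      rw [Finset.sum_comm' (t' := Finset.univ) (s' := fun _ => Finset.univ) (by simp)]
      rw [eq_comm, Finset.sum_comm, eq_comm, Finset.sum_comm]
      refine Finset.sum_congr rfl fun p _ => ?_
      rw [Finset.sum_comm]
      exact Finset.sum_congr rfl fun q _ => Finset.sum_congr rfl fun x _ => by ring
    rw [hexp, Complex.ofReal_add, ← hdiag, ← hsq, ← Finset.sum_add_distrib]
    refine Finset.sum_congr rfl fun p _ => ?_
    rw [← Finset.sum_add_distrib]
    refine Finset.sum_congr rfl fun q _ => ?_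
    rw [hG, Complex.ofReal_add, mul_add]
  rw [key, Complex.ofReal_im, Complex.ofReal_re]
  refine ⟨rfl, add_pos_of_pos_of_nonneg (mul_pos hα ?_)
    (mul_nonneg hβ (Finset.sum_nonneg fun _ _ => Complex.normSq_nonneg _))⟩
  -- The family need not be independent: any expression of $v\ne0$ has a nonzero coefficient.
  obtain ⟨p, hp⟩ : ∃ p, a p ≠ 0 := by
    by_contra! hall
    exact hv0 (by simp [hall])
  exact Finset.sum_pos' (fun _ _ => Complex.normSq_nonneg _)
    ⟨p, Finset.mem_univ _, Complex.normSq_pos.2 hp⟩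

/-- An edge meets itself in two vertices, so the incidence term contributes $ch/4$ to the diagonal
and $c/2-ch/4$ remains. -/
theorem gramEntry_eq_incidence (c h : ℝ) {n : ℕ} (p q : Fin n × Fin n)
    (hp : p.1 < p.2) (hq : q.1 < q.2) :
    gramEntry c h p q = (if p = q then c / 2 * (1 - h / 2) else 0) + c * h / 8 *
      ∑ x : Fin n, (if x ∈ ({p.1, p.2} : Finset (Fin n)) then 1 else 0 : ℝ) *
        (if x ∈ ({q.1, q.2} : Finset (Fin n)) then 1 else 0) := by
  have hsum : ∑ x : Fin n, (if x ∈ ({p.1, p.2} : Finset (Fin n)) then 1 else 0 : ℝ) *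
      (if x ∈ ({q.1, q.2} : Finset (Fin n)) then 1 else 0) =
      (({p.1, p.2} : Finset (Fin n)) ∩ {q.1, q.2}).card := by
    simp only [← ite_and, mul_ite, mul_one, mul_zero, ← Finset.mem_inter]
    rw [Finset.card_eq_sum_ones, ← Finset.sum_filter]
    push_cast
    refine Finset.sum_congr ?_ fun _ _ => rfl
    ext x
    simp only [Finset.mem_filter, Finset.mem_univ, true_and, Finset.mem_inter, and_comm]
  rw [hsum, gramEntry]
  split_ifs with hpq
  · subst hpq
    rw [Finset.inter_self, Finset.card_pair hp.ne]
    push_cast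
    ring
  · ring

/-- Distinct 2-subsets of a 3-set meet in exactly one point, so all off-diagonal entries are equal.
-/
theorem gramEntry_fin_three (c h : ℝ) (p q : Fin 3 × Fin 3) (hp : p.1 < p.2) (hq : q.1 < q.2) :
    gramEntry c h p q = (if p = q then c / 2 * (1 - h / 4) else 0) + c * h / 8 := by
  rw [gramEntry]
  split_ifs with hpq
  · ring
  · have hcard : ∀ p q : Fin 3 × Fin 3, p.1 < p.2 → q.1 < q.2 → p ≠ q →
        (({p.1, p.2} : Finset (Fin 3)) ∩ {q.1, q.2}).card = 1 := by decide
    rw [hcard p q hp hq hpq]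
    push_cast
    ring

theorem centralChargeC_eq_ofReal (m : ℕ) :
    centralChargeC m = ((m * (m + 5) / ((m + 2) * (m + 3)) : ℝ) : ℂ) := by
  have h2 : (m : ℂ) + 2 ≠ 0 := by exact_mod_cast Nat.succ_ne_zero (m + 1)
  have h3 : (m : ℂ) + 3 ≠ 0 := by exact_mod_cast Nat.succ_ne_zero (m + 2)
  rw [centralChargeC]
  push_cast
  field_simp
  ring

theorem weightH_eq_ofReal (m : ℕ) :
    weightH m (m + 1) 1 = ((m * (m + 1) / 4 : ℝ) : ℂ) := by
  have h2 : (m : ℂ) + 2 ≠ 0 := by exact_mod_cast Nat.succ_ne_zero (m + 1)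
  have h3 : (m : ℂ) + 3 ≠ 0 := by exact_mod_cast Nat.succ_ne_zero (m + 2)
  rw [weightH]
  push_cast
  field_simp
  ring

namespace VertexOperatorAlgebra

/-- Allowing $v=0$ avoids proving that the test vectors are nonzero; the weak bounds suffice because
$h$ jumps over 2 and 4. -/
theorem PositiveDefiniteOn.re_apply_nonneg {V : Type*} [AddCommGroup V] [Module ℂ V]
    {H : V →ₗ[ℂ] V →ₛₗ[starRingEnd ℂ] ℂ} {W : Submodule ℂ V}
    (hpos : PositiveDefiniteOn H W) {v : V} (hv : v ∈ W) : 0 ≤ (H v v).re := by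
  by_cases h0 : v = 0
  · simp [h0]
  · exact (hpos v hv h0).2.le

end VertexOperatorAlgebra

open VertexOperatorAlgebra in
theorem mainTheorem4 {V : Type*} [AddCommGroup V] [Module ℂ V] (A : VertexOperatorAlgebra V)
    (n m : ℕ) (hn : 3 ≤ n) (hm : 2 ≤ m) (om : Fin n → Fin n → V)
    (hI : A.ConditionI) (hII : A.ConditionII n m om)
    (H : V →ₗ[ℂ] V →ₛₗ[starRingEnd ℂ] ℂ) (hH : A.IsAssociatedHermitianForm om H) :
    (n = 3 → (VertexOperatorAlgebra.PositiveDefiniteOn H (A.gr 2) ↔ m ≤ 3)) ∧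
      (4 ≤ n → (VertexOperatorAlgebra.PositiveDefiniteOn H (A.gr 2) ↔ m = 2)) := by
  obtain ⟨c, hc, hc0⟩ : ∃ c : ℝ, centralChargeC m = c ∧ 0 < c :=
    ⟨_, centralChargeC_eq_ofReal m, by positivity⟩
  obtain ⟨h, hh, hval⟩ : ∃ h : ℝ, weightH m (m + 1) 1 = h ∧ h = m * (m + 1) / 4 :=
    ⟨_, weightH_eq_ofReal m, rfl⟩
  have hh0 : 0 ≤ h := by rw [hval]; positivity
  have hgram := hermitian_apply_eq_gramEntry hI.oz.2.2 hII hH hc hh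
  have hmem : ∀ i j : Fin n, i < j → om i j ∈ A.gr 2 := fun i j hij =>
    (hII.virasoro i j hij.ne).1
  let e : {p : Fin n × Fin n // p.1 < p.2} → V := fun p => om p.1.1 p.1.2
  have hspan : A.gr 2 = Submodule.span ℂ (Set.range e) := by
    rw [hII.span]
    congr 1
    ext v
    constructor
    · rintro ⟨i, j, hij, rfl⟩
      exact ⟨⟨(i, j), hij⟩, rfl⟩
    · rintro ⟨⟨⟨i, j⟩, hij⟩, rfl⟩
      exact ⟨i, j, hij, rfl⟩
  have hgram_lt : ∀ i j k l : Fin n, i < j → k < l →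
      H (om i j) (om k l) = (gramEntry c h (i, j) (k, l) : ℂ) := fun i j k l hij hkl =>
    hgram (i, j) (k, l) hij hkl
  refine ⟨?_, fun hn4 => ⟨fun hpos => ?_, ?_⟩⟩
  · rintro rfl
    refine ⟨fun hpos => ?_, fun hm3 v hv hv0 => ?_⟩
    · have h01 : (0 : Fin 3) < 1 := by decide
      have h02 : (0 : Fin 3) < 2 := by decide
      have hnn := hpos.re_apply_nonneg (sub_mem (hmem 0 1 h01) (hmem 0 2 h02))
      simp only [map_sub, LinearMap.sub_apply, hgram_lt _ _ _ _ h01 h01, hgram_lt _ _ _ _ h01 h02,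
        hgram_lt _ _ _ _ h02 h01, hgram_lt _ _ _ _ h02 h02, gramEntry_self,
        gramEntry_of_mem c h 0 h01 h02 (by decide) (by decide) (by decide),
        gramEntry_of_mem c h 0 h02 h01 (by decide) (by decide) (by decide),
        Complex.sub_re, Complex.ofReal_re] at hnn
      -- The norm is $2\cdot\frac c2-2\cdot\frac{ch}8$.
      have hle : 0 ≤ c * (1 - h / 4) := by linarith
      have h4 : h ≤ 4 := by
        have := nonneg_of_mul_nonneg_right hle hc0
        linarith
      by_contra! hm4
      have hm4' : (4 : ℝ) ≤ m := by exact_mod_cast hm4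
      nlinarith
    · refine sesqForm_pos_of_gram (κ := Unit) H e (c / 2 * (1 - h / 4)) (c * h / 8)
        (mul_pos (by positivity) ?_) (by positivity) (fun _ _ => 1) (fun p q => ?_) v
        (hspan ▸ hv) hv0
      · have hm3' : (m : ℝ) ≤ 3 := by exact_mod_cast hm3
        nlinarith
      · rw [hgram p.1 q.1 p.2 q.2, gramEntry_fin_three _ _ _ _ p.2 q.2]
        simp [Subtype.ext_iff]
  · obtain ⟨i, j, k, l, hij, hjk, hkl⟩ : ∃ i j k l : Fin n, i < j ∧ j < k ∧ k < l :=
      ⟨⟨0, by omega⟩, ⟨1, by omega⟩, ⟨2, by omega⟩, ⟨3, by omega⟩, by simp, by simp, by simp⟩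
    have hil : i < l := hij.trans (hjk.trans hkl)
    -- Signs alternate around the 4-cycle $i,j,k,l$, so $N$ kills this vector and its norm is
    -- $4\cdot\frac c2(1-\frac h2)$.
    have hnn := hpos.re_apply_nonneg (sub_mem (add_mem (hmem i j hij) (hmem k l hkl))
      (add_mem (hmem j k hjk) (hmem i l hil)))
    have hik : i ≠ k := (hij.trans hjk).ne
    have hjl : j ≠ l := (hjk.trans hkl).ne
    simp only [map_sub, map_add, LinearMap.sub_apply, LinearMap.add_apply,
      hgram_lt _ _ _ _ hij hij, hgram_lt _ _ _ _ hij hkl, hgram_lt _ _ _ _ hij hjk,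
      hgram_lt _ _ _ _ hij hil, hgram_lt _ _ _ _ hkl hij, hgram_lt _ _ _ _ hkl hkl,
      hgram_lt _ _ _ _ hkl hjk, hgram_lt _ _ _ _ hkl hil, hgram_lt _ _ _ _ hjk hij,
      hgram_lt _ _ _ _ hjk hkl, hgram_lt _ _ _ _ hjk hjk, hgram_lt _ _ _ _ hjk hil,
      hgram_lt _ _ _ _ hil hij, hgram_lt _ _ _ _ hil hkl, hgram_lt _ _ _ _ hil hjk,
      hgram_lt _ _ _ _ hil hil, gramEntry_self,
      gramEntry_of_disjoint c h hik hil.ne hjk.ne hjl,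
      gramEntry_of_disjoint c h hik.symm hjk.ne' hil.ne' hjl.symm,
      gramEntry_of_disjoint c h hij.ne' hjl hik.symm hkl.ne,
      gramEntry_of_disjoint c h hij.ne hik hjl.symm hkl.ne',
      gramEntry_of_mem c h j hij hjk (.inl hij.ne) (.inr rfl) (.inl rfl),
      gramEntry_of_mem c h j hjk hij (.inl hij.ne') (.inl rfl) (.inr rfl),
      gramEntry_of_mem c h i hij hil (.inr hjl) (.inl rfl) (.inl rfl),
      gramEntry_of_mem c h i hil hij (.inr hjl.symm) (.inl rfl) (.inl rfl),
      gramEntry_of_mem c h k hkl hjk (.inl hjk.ne') (.inl rfl) (.inr rfl),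
      gramEntry_of_mem c h k hjk hkl (.inl hjk.ne) (.inr rfl) (.inl rfl),
      gramEntry_of_mem c h l hkl hil (.inl hik.symm) (.inr rfl) (.inr rfl),
      gramEntry_of_mem c h l hil hkl (.inl hik) (.inr rfl) (.inr rfl),
      Complex.sub_re, Complex.add_re, Complex.ofReal_re] at hnn
    have hle : 0 ≤ c * (2 - h) := by linarith
    have h2 : h ≤ 2 := by
      have := nonneg_of_mul_nonneg_right hle hc0
      linarith
    by_contra hm2
    have hm3 : (3 : ℝ) ≤ m := by exact_mod_cast (by omega : 3 ≤ m)
    nlinarith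
  · rintro rfl v hv hv0
    refine sesqForm_pos_of_gram H e (c / 2 * (1 - h / 2)) (c * h / 8)
      (mul_pos (by positivity) ?_) (by positivity)
      (fun (x : Fin n) p => if x ∈ ({p.1.1, p.1.2} : Finset (Fin n)) then 1 else 0)
      (fun p q => ?_) v (hspan ▸ hv) hv0
    · norm_num at hval
      linarith
    · rw [hgram p.1 q.1 p.2 q.2, gramEntry_eq_incidence _ _ _ _ p.2 q.2]
      simp only [Subtype.ext_iff]

end
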